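/- Notation. An $(n,m)$-function is a map $F:\mathbb F_2^n\to\mathbb F_2^m$. It is $k$th-order sum-free if $\sum_{x\in A}F(x)\neq 0$ for every $k$-dimensional affine subspace $A\subseteq\mathbb F_2^n$. A $k$th-order sum-free $(n,m)$-function $F$ is non-degenerate if for every nonzero $v\in\mathbb F_2^m$ the Boolean function $x\mapsto v\cdot F(x)$ has algebraic degree (the degree of its algebraic normal form) at least $k$. $\mathrm{RM}(r,n)\subseteq\mathbb F_2^{2^n}$ is the code of evaluation vectors, on the points of $\mathbb F_2^n$, of the polynomials in $\mathbb F_2[x_1,\dots,x_n]$ of degree at most $r$. A parity-check matrix of a linear code $\mathcal C$ is a matrix with linearly independent rows whose kernel is $\mathcal C$. For an $(n,m)$-function $F$, let $M_F$ be the $m\times 2^n$ matrix with column $F(x)$ at the coordinate $x\in\mathbb F_2^n$. Theorem 1.1 (Equivalence). Let $r,m,n$ be positive integers with $2\le r\le n-2$ and $m\le n$. (1) Let $\mathcal C\subseteq\mathrm{RM}(r,n)$ be a linear subcode of codimension $m$ in $\mathrm{RM}(r,n)$ with minimum distance $3\cdot 2^{n-r-1}$. Then there is a non-degenerate $(n-r)$th-order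 sum-free $(n,m)$-function $F$ such that, for every parity-check matrix $H$ of $\mathrm{RM}(r,n)$, the matrix $\begin{bmatrix}H\\ M_F\end{bmatrix}$ is a parity-check matrix of $\mathcal C$. Moreover, whenever $H$ is a parity-check matrix of $\mathrm{RM}(r,n)$ and $F$ is an $(n,m)$-function such that $\begin{bmatrix}H\\ M_F\end{bmatrix}$ is a parity-check matrix of $\mathcal C$, the function $F$ is $(n-r)$th-order sum-free and non-degenerate. (2) Conversely, let $F$ be a non-degenerate $(n-r)$th-order sum-free $(n,m)$-function. Then there is a linear subcode $\mathcal C_F\subseteq\mathrm{RM}(r,n)$, of codimension $m$ in $\mathrm{RM}(r,n)$ and with minimum distance exactly $3\cdot 2^{n-r-1}$, such that for every parity-check matrix $H$ of $\mathrm{RM}(r,n)$ the matrix $\begin{bmatrix}H\\ M_F\end{bmatrix}$ is a parity-check matrix of $\mathcal C_F$. -/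

import Mathlib

/-- The points of `F_2^n`. -/
abbrev Pt (n : ℕ) : Type := Fin n → ZMod 2

/-- Binary words of length `2^n`, with coordinates indexed by the points of `F_2^n`; equivalently,
Boolean functions in `n` variables. -/
abbrev Word (n : ℕ) : Type := Pt n → ZMod 2

/-- The Reed-Muller code: evaluation vectors of the polynomials over `F_2` in `n` variables of
total degree at most `r`. -/
noncomputable def reedMuller (r n : ℕ) : Submodule (ZMod 2) (Word n) :=
  (MvPolynomial.restrictTotalDegree (Fin n) (ZMod 2) r).map
    (MvPolynomial.evalₗ (ZMod 2) (Fin n))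

theorem mem_reedMuller {r n : ℕ} {c : Word n} :
    c ∈ reedMuller r n ↔
      ∃ p : MvPolynomial (Fin n) (ZMod 2), p.totalDegree ≤ r ∧
        ∀ a : Pt n, MvPolynomial.eval a p = c a := by
  simp only [reedMuller, Submodule.mem_map, MvPolynomial.mem_restrictTotalDegree]
  exact exists_congr fun p => and_congr_right fun _ => funext_iff

/-- Every Boolean function has a unique algebraic normal form, that is, it is represented by a
unique polynomial in which every variable has degree at most one. -/
theorem existsUnique_anf {n : ℕ} (f : Word n) :
    ∃! p : MvPolynomial (Fin n) (ZMod 2),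
      p ∈ MvPolynomial.restrictDegree (Fin n) (ZMod 2) 1 ∧
        ∀ a : Pt n, MvPolynomial.eval a p = f a := by
  have hf : f ∈ (MvPolynomial.restrictDegree (Fin n) (ZMod 2) (Fintype.card (ZMod 2) - 1)).map
      (MvPolynomial.evalₗ (ZMod 2) (Fin n)) := by
    rw [MvPolynomial.map_restrict_dom_evalₗ]
    exact Submodule.mem_top
  obtain ⟨p, hp, hpf⟩ := Submodule.mem_map.1 hf
  refine ⟨p, ⟨hp, fun a => congrFun hpf a⟩, ?_⟩
  rintro q ⟨hq, hqf⟩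
  have h0 : q - p = 0 := by
    refine MvPolynomial.eq_zero_of_eval_eq_zero (Fin n) (ZMod 2) (q - p) (fun v => ?_)
      (Submodule.sub_mem _ hq hp)
    have := congrFun hpf v
    rw [MvPolynomial.evalₗ_apply] at this
    rw [map_sub, hqf v, this, sub_self]
  exact sub_eq_zero.1 h0

/-- The algebraic normal form of a Boolean function. -/
noncomputable def anf {n : ℕ} (f : Word n) : MvPolynomial (Fin n) (ZMod 2) :=
  (existsUnique_anf f).choose

theorem anf_spec {n : ℕ} (f : Word n) :
    anf f ∈ MvPolynomial.restrictDegree (Fin n) (ZMod 2) 1 ∧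
      ∀ a : Pt n, MvPolynomial.eval a (anf f) = f a :=
  (existsUnique_anf f).choose_spec.1

theorem anf_unique {n : ℕ} (f : Word n) (p : MvPolynomial (Fin n) (ZMod 2))
    (hp : p ∈ MvPolynomial.restrictDegree (Fin n) (ZMod 2) 1)
    (hpf : ∀ a : Pt n, MvPolynomial.eval a p = f a) : p = anf f :=
  (existsUnique_anf f).choose_spec.2 p ⟨hp, hpf⟩

/-- The algebraic degree of a Boolean function (`0` for the zero function). -/
noncomputable def algDegree {n : ℕ} (f : Word n) : ℕ := (anf f).totalDegree

/-- `A` is a `k`-flat, i.e. a (nonempty) affine subspace of dimension `k`. -/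
def IsFlat {n : ℕ} (k : ℕ) (A : AffineSubspace (ZMod 2) (Pt n)) : Prop :=
  (A : Set (Pt n)).Nonempty ∧ Module.finrank (ZMod 2) A.direction = k

open Classical in
/-- `F` is `k`th-order sum-free: its values over any `k`-flat have a nonzero sum. -/
def IsSumFree {n m : ℕ} (k : ℕ) (F : Pt n → Pt m) : Prop :=
  ∀ A : AffineSubspace (ZMod 2) (Pt n), IsFlat k A → ∑ x : Pt n with x ∈ A, F x ≠ 0

/-- The Boolean function `x ↦ v · F x`; for `v ≠ 0` this is a component function of `F`. -/
def component {n m : ℕ} (F : Pt n → Pt m) (v : Pt m) : Word n := fun x => v ⬝ᵥ F x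

/-- `F` is degree-`k` degenerate: some component function of `F` has algebraic degree less
than `k`. A `k`th-order sum-free function is called degenerate if this holds. -/
def IsDegenerate {n m : ℕ} (k : ℕ) (F : Pt n → Pt m) : Prop :=
  ∃ v : Pt m, v ≠ 0 ∧ algDegree (component F v) < k

/-- `d` is the minimum Hamming distance between two distinct codewords of `C`. -/
def HasMinDist {n : ℕ} (C : Submodule (ZMod 2) (Word n)) (d : ℕ) : Prop :=
  IsLeast {e : ℕ | ∃ x ∈ C, ∃ y ∈ C, x ≠ y ∧ hammingDist x y = e} d

/-- `H` is a parity-check matrix of the linear code `C`: its rows are linearly independent and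
`C` is its kernel. -/
def IsParityCheckMatrix {n : ℕ} {ι : Type*} (H : Matrix ι (Pt n) (ZMod 2))
    (C : Submodule (ZMod 2) (Word n)) : Prop :=
  LinearIndependent (ZMod 2) H.row ∧ ∀ c : Word n, c ∈ C ↔ H.mulVec c = 0

/-- Every linear code has a parity-check matrix. -/
theorem exists_parityCheckMatrix {n : ℕ} (C : Submodule (ZMod 2) (Word n)) :
    ∃ (s : ℕ) (H : Matrix (Fin s) (Pt n) (ZMod 2)), IsParityCheckMatrix H C := by
  let e := (Module.finBasis (ZMod 2) (Word n ⧸ C)).equivFun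
  let f : Word n →ₗ[ZMod 2] (Fin _ → ZMod 2) := e.toLinearMap ∘ₗ C.mkQ
  have hf : Function.Surjective f := e.surjective.comp C.mkQ_surjective
  refine ⟨_, LinearMap.toMatrix' f, ?_, fun c => ?_⟩
  · rw [← Matrix.vecMul_injective_iff]
    intro v w hvw
    refine dotProduct_eq _ _ fun u => ?_
    obtain ⟨c, rfl⟩ := hf u
    rw [← LinearMap.toMatrix'_mulVec f c, Matrix.dotProduct_mulVec, Matrix.dotProduct_mulVec]
    exact congrArg (· ⬝ᵥ c) hvw
  · rw [LinearMap.toMatrix'_mulVec]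
    simp [f]

/-- The `m × 2^n` matrix whose column at the point `x` is `F x`. -/
def valueMatrix {n m : ℕ} (F : Pt n → Pt m) : Matrix (Fin m) (Pt n) (ZMod 2) :=
  Matrix.of fun i x => F x i

/-!
The two sides of the correspondence are matched by the formula
`C = {c ∈ RM(r, n) | ∑ x, c x • F x = 0}`, where `∑ x, c x • F x` is `valueMatrix F *ᵥ c`.

*Linear algebra.* The matrix `[H; M_F]` is a parity-check matrix of `C` for every parity-check
matrix `H` of `RM(r, n)` as soon as `C` is given by this formula and `c ↦ M_F c` maps `RM(r, n)`
onto `F_2^m` (`isParityCheckMatrix_fromRows`), and conversely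
(`mem_and_surjective_of_isParityCheckMatrix_fromRows`). Surjectivity fails exactly when some
component `v · F` with `v ≠ 0` is orthogonal to `RM(r, n)`; since the dual of `RM(r, n)` consists of
the functions of degree less than `n - r`, surjectivity is non-degeneracy (`not_isDegenerate_iff`).

*Minimum distance.* Indicators of `(n - r)`-flats lie in `RM(r, n)` and have weight `2^(n-r)`, so a
code `C` of minimum distance `3 * 2^(n-r-1)` contains none of them, which is sum-freeness of `F`.
In the other direction, the start of the Kasami-Tokura weight theorem is needed: a nonzero word of
`RM(r, n)` of weight less than `3 * 2^(n-r-1)` is the indicator of an `(n - r)`-flat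
(`HasDegLE.support_eq_flat`). It is proved by restricting to hyperplanes, with the degree of a
Boolean function expressed through iterated derivatives, so that restriction to a flat is harmless.

That the bound is attained is a pigeonhole argument (`hasMinDist_of_isSumFree`). With `k = n - r`,
the graphs of linear maps `F_2^k → F_2^r` are `k`-flats. Among the maps that factor through a fixed
surjection `F_2^k → F_2^2`, or through a fixed injection `F_2^2 → F_2^r`, there are
`2^(2 max (k, r)) ≥ 2^n ≥ 2^m`, while the sums of `F` over their graphs avoid `0`; hence two graphs
have the same sum. They meet in codimension at most `2`, so their symmetric difference is a
word of `C` of weight at most `3 * 2^(k-1)`.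
-/

/-! ### Degree through derivatives -/

section Derivatives

variable {V : Type} [AddCommGroup V]

/-- `f` has algebraic degree at most `r`, expressed without coordinates: all derivatives of order
`r + 1` of `f` vanish. The recursion takes one derivative `x ↦ f (x + u) + f x` per step. -/
def HasDegLE : ℕ → (V → ZMod 2) → Prop
  | 0, f => ∀ u x, f (x + u) = f x
  | r + 1, f => ∀ u, HasDegLE r fun x => f (x + u) + f x

theorem HasDegLE.const (r : ℕ) (a : ZMod 2) : HasDegLE r fun _ : V => a := by
  induction r generalizing a with
  | zero => exact fun _ _ => rfl
  | succ r ih => exact fun u => ih (a + a)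

theorem HasDegLE.comp_add {r : ℕ} {f : V → ZMod 2} (hf : HasDegLE r f) {W : Type}
    [AddCommGroup W] (L : W →+ V) (b : V) : HasDegLE r fun w => f (b + L w) := by
  induction r generalizing f with
  | zero => intro u x; simpa [add_assoc] using hf (L u) (b + L x)
  | succ r ih => intro u; simpa [add_assoc] using ih (hf (L u))

theorem HasDegLE.add {r : ℕ} {f g : V → ZMod 2} (hf : HasDegLE r f) (hg : HasDegLE r g) :
    HasDegLE r fun x => f x + g x := by
  induction r generalizing f g with
  | zero => intro u x; simp only [hf u x, hg u x]
  | succ r ih =>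
    intro u
    convert ih (hf u) (hg u) using 2
    ring

theorem HasDegLE.succ {r : ℕ} {f : V → ZMod 2} (hf : HasDegLE r f) : HasDegLE (r + 1) f := by
  induction r generalizing f with
  | zero =>
    intro u v x
    have h : ∀ y, f (y + u) = f y := hf u
    simp only [h, CharTwo.add_self_eq_zero]
  | succ r ih => exact fun u => ih (hf u)

theorem HasDegLE.mono {r s : ℕ} {f : V → ZMod 2} (hf : HasDegLE r f) (h : r ≤ s) :
    HasDegLE s f := by
  induction s, h using Nat.le_induction with
  | base => exact hf
  | succ s _ ih => exact ih.succ

theorem HasDegLE.mul_hom {r : ℕ} {f : V → ZMod 2} (hf : HasDegLE r f) (l : V →+ ZMod 2) :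
    HasDegLE (r + 1) fun x => l x * f x := by
  induction r generalizing f with
  | zero =>
    intro u v x
    have h : ∀ u y, f (y + u) = f y := hf
    simp only [map_add, h]
    linear_combination (l v * f x) * CharTwo.two_eq_zero (R := ZMod 2)
  | succ r ih =>
    intro u
    have h1 := ih (hf u)
    have h2 : HasDegLE (r + 1) fun x => l u * f (x + u) := by
      have h3 := hf.comp_add (AddMonoidHom.id V) u
      rcases (by decide : ∀ a : ZMod 2, a = 0 ∨ a = 1) (l u) with h | h
      · simpa [h] using HasDegLE.const (V := V) (r + 1) 0
      · simpa [h, add_comm] using h3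
    convert h1.add h2 using 2 with x
    simp only [map_add]
    ring

end Derivatives

open Function in
/-- The minimum distance of the Reed-Muller code: unless `f` is constant, some derivative of `f` is a
nonzero function of degree at most `r - 1`, and its support is at most twice that of `f`. -/
theorem HasDegLE.card_le_two_pow_mul_ncard_support {V : Type} [AddCommGroup V] [Finite V] {r : ℕ}
    {f : V → ZMod 2} (hf : HasDegLE r f) (h0 : f ≠ 0) :
    Nat.card V ≤ 2 ^ r * (support f).ncard := by
  induction r generalizing f with
  | zero =>
    obtain ⟨a, ha⟩ := Function.ne_iff.1 h0
    have : support f = Set.univ := by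
      ext x
      have h := hf (x - a) a
      rw [add_sub_cancel] at h
      simpa [h] using ha
    simp [this, Set.ncard_univ]
  | succ r ih =>
    by_cases hd : ∃ u, (fun x => f (x + u) + f x) ≠ 0
    · obtain ⟨u, hu⟩ := hd
      refine (ih (hf u) hu).trans ?_
      have hsub : support (fun x => f (x + u) + f x) ⊆
          (fun x => x - u) '' support f ∪ support f := by
        intro x hx
        by_cases hfx : f x = 0
        · left
          refine ⟨x + u, ?_, by simp⟩
          simpa [hfx] using hx
        · exact Or.inr hfx
      have h1 := (Set.ncard_le_ncard hsub).trans (Set.ncard_union_le _ _)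
      have h2 := Set.ncard_image_le (f := fun x => x - u) (s := support f)
      rw [pow_succ, mul_assoc]
      gcongr
      omega
    · push Not at hd
      have hc : HasDegLE 0 f := by
        intro u x
        have := congrFun (hd u) x
        simpa [CharTwo.add_eq_zero] using this
      obtain ⟨a, ha⟩ := Function.ne_iff.1 h0
      have : support f = Set.univ := by
        ext x
        have h := hc (x - a) a
        rw [add_sub_cancel] at h
        simpa [h] using ha
      rw [this, Set.ncard_univ]
      exact Nat.le_mul_of_pos_left _ (by positivity)

/-! ### Functions of small weight -/

theorem ncard_inter_of_subset {α : Type*} [Finite α] {S P Q : Set α} (h : ∀ x ∈ S, x ∈ P → x ∈ Q) :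
    (S ∩ Q).ncard = (S ∩ P).ncard + ((S \ P) ∩ Q).ncard := by
  rw [← Set.ncard_inter_add_ncard_sdiff_eq_ncard (S ∩ Q) P]
  congr 2
  · ext x
    exact ⟨fun hx => ⟨hx.1.1, hx.2⟩, fun hx => ⟨⟨hx.1, h x hx.1 hx.2⟩, hx.2⟩⟩
  · ext x
    exact ⟨fun hx => ⟨⟨hx.1.1, hx.2⟩, hx.1.2⟩, fun hx => ⟨⟨hx.1.1, hx.2⟩, hx.1.2⟩⟩

open Function in
theorem ncard_support_restrict_hyperplane {V : Type} [AddCommGroup V] [Module (ZMod 2) V]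
    (f : V → ZMod 2) (l : V →ₗ[ZMod 2] ZMod 2) (p : V) :
    (support fun w : LinearMap.ker l => f (p + w)).ncard =
      (support f ∩ {x | l x = l p}).ncard := by
  refine Set.ncard_congr (fun w _ => p + (w : V)) ?_ ?_ ?_
  · intro w hw
    exact ⟨hw, by simp⟩
  · intro w w' _ _ h
    exact Subtype.ext (add_left_cancel h)
  · rintro x ⟨hx, hlx⟩
    have hlx : l x = l p := hlx
    exact ⟨⟨x - p, by simp [hlx]⟩, by simpa using hx, by simp⟩

open Function in
theorem HasDegLE.two_pow_le_ncard_support_inter {V : Type} [AddCommGroup V] [Module (ZMod 2) V]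
    [Finite V] {e r : ℕ} (hV : Module.finrank (ZMod 2) V = e + 1) (hre : r ≤ e) {f : V → ZMod 2}
    (hf : HasDegLE r f)
    {l : V →ₗ[ZMod 2] ZMod 2} (hl : l ≠ 0) {p : V} (hp : f p ≠ 0) :
    2 ^ (e - r) ≤ (support f ∩ {x | l x = l p}).ncard := by
  have hK : Module.finrank (ZMod 2) (LinearMap.ker l) = e := by
    have := Module.Dual.finrank_ker_add_one_of_ne_zero hl
    omega
  have hg : HasDegLE r fun w : LinearMap.ker l => f (p + w) :=
    hf.comp_add (LinearMap.ker l).subtype.toAddMonoidHom p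
  have h0 : (fun w : LinearMap.ker l => f (p + w)) ≠ 0 :=
    fun h => hp (by simpa using congrFun h 0)
  have := hg.card_le_two_pow_mul_ncard_support h0
  rw [ncard_support_restrict_hyperplane, Module.natCard_eq_pow_finrank (K := ZMod 2), hK,
    Nat.card_zmod, ← Nat.add_sub_of_le hre, pow_add] at this
  simpa using Nat.le_of_mul_le_mul_left this (by positivity)

open Function in
/-- A nonzero function of degree at most `r` whose weight is less than `3 / 2` times the minimum
`2 ^ (e - r)` is the indicator of an `(e - r)`-flat.

If `f` vanishes on a hyperplane, then on the complementary one it coincides with a derivative of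
`f`, and the induction hypothesis applies in degree `r - 1`. Otherwise the smaller half of the support
with respect to any hyperplane is a flat of size `2 ^ (e - r - 1)`, and comparing three hyperplanes
through one such half gives a contradiction. -/
theorem HasDegLE.support_eq_flat {e : ℕ} {V : Type} [AddCommGroup V] [Module (ZMod 2) V] [Finite V]
    (hV : Module.finrank (ZMod 2) V = e) {r : ℕ} (hre : r ≤ e) {f : V → ZMod 2}
    (hf : HasDegLE r f) (h0 : f ≠ 0) (hw : 2 * (support f).ncard < 3 * 2 ^ (e - r)) :
    ∃ (b : V) (U : Submodule (ZMod 2) V), Module.finrank (ZMod 2) U = e - r ∧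
      ∀ x, f x ≠ 0 ↔ x - b ∈ U := by
  induction e generalizing V r with
  | zero =>
    obtain rfl : r = 0 := by omega
    have := Module.finrank_zero_iff (R := ZMod 2) (M := V).1 hV
    obtain ⟨a, ha⟩ := Function.ne_iff.1 h0
    exact ⟨0, ⊤, by simp [hV], fun x => by simpa [Subsingleton.elim x a] using ha⟩
  | succ e ih =>
    obtain ⟨a, ha⟩ := Function.ne_iff.1 h0
    rcases Nat.eq_zero_or_pos r with rfl | hr
    · refine ⟨0, ⊤, by simp [hV], fun x => ?_⟩
      have h := hf (x - a) a
      rw [add_sub_cancel] at h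
      simpa [h] using ha
    rcases Nat.eq_or_lt_of_le hre with rfl | hre
    · refine ⟨a, ⊥, by simp, fun x => ?_⟩
      rw [Submodule.mem_bot, sub_eq_zero]
      refine ⟨fun hx => ?_, fun h => h ▸ ha⟩
      -- here the weight bound reads `2 * |supp f| < 3`
      exact Set.ncard_le_one_iff (s := support f).1 (by simp at hw; omega) hx ha
    have hre : r ≤ e := by omega
    have hker : ∀ l : V →ₗ[ZMod 2] ZMod 2, l ≠ 0 →
        Module.finrank (ZMod 2) (LinearMap.ker l) = e := fun l hl => by
      have := Module.Dual.finrank_ker_add_one_of_ne_zero hl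
      omega
    have hres : ∀ (s : ℕ) (l : V →ₗ[ZMod 2] ZMod 2) (p : V), HasDegLE s f →
        HasDegLE s fun w : LinearMap.ker l => f (p + w) := fun s l p h =>
      h.comp_add (LinearMap.ker l).subtype.toAddMonoidHom p
    have hz2 : ∀ {a b : ZMod 2}, a ≠ b → ∀ c, c ≠ a → c = b := by decide
    by_cases hvan : ∃ (l : V →ₗ[ZMod 2] ZMod 2) (c : ZMod 2), l ≠ 0 ∧ ∀ x, l x = c → f x = 0
    · obtain ⟨l, c, hl, hvan⟩ := hvan
      obtain ⟨s, rfl⟩ : ∃ s, r = s + 1 := ⟨r - 1, by omega⟩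
      -- `f` is supported on `{x | l x = l a}`; there it equals its derivative along any `u` with
      -- `l u ≠ 0`, because `f` vanishes at `x + u`
      have hac : l a ≠ c := fun h => ha (hvan a h)
      obtain ⟨u, hu⟩ : ∃ u, l u ≠ 0 := by
        by_contra! h
        exact hl (LinearMap.ext h)
      have hg : HasDegLE s fun w : LinearMap.ker l => f (a + w) := by
        have := (hf u).comp_add (LinearMap.ker l).subtype.toAddMonoidHom a
        convert this using 2 with w
        have : f (a + w + u) = 0 := by
          refine hvan _ (hz2 hac _ ?_)
          simpa using hu
        simp [this]
      have hS : (support fun w : LinearMap.ker l => f (a + w)).ncard = (support f).ncard := by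
        rw [ncard_support_restrict_hyperplane]
        congr 1
        refine Set.inter_eq_left.2 fun x hx => ?_
        exact hz2 hac.symm _ fun h => hx (hvan x h)
      obtain ⟨b, U, hU, hb⟩ := ih (hker l hl) (by omega) hg
        (fun h => ha (by simpa using congrFun h 0)) (by
          rw [hS]
          rwa [show e + 1 - (s + 1) = e - s by omega] at hw)
      refine ⟨a + b, U.map (LinearMap.ker l).subtype, ?_, fun x => ?_⟩
      · rw [LinearEquiv.finrank_eq (Submodule.equivSubtypeMap _ U).symm, hU]
        omega
      · constructor
        · intro hx
          have hlx : l x = l a := hz2 hac.symm _ fun h => hx (hvan x h)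
          have := (hb ⟨x - a, by simp [hlx]⟩).1 (by simpa using hx)
          refine ⟨_, this, by simp [sub_sub]⟩
        · rintro ⟨w, hw, hwx⟩
          have := (hb (w + b)).2 (by simpa using hw)
          have hx : x = a + (w + b : LinearMap.ker l) := by
            rw [eq_add_of_sub_eq hwx.symm]
            simp
            abel
          rwa [hx]
    · push Not at hvan
      exfalso
      set S := support f with hSdef
      have hsplit : ∀ (l : V →ₗ[ZMod 2] ZMod 2) (p q : V), l p ≠ l q →
          (S ∩ {x | l x = l p}).ncard + (S ∩ {x | l x = l q}).ncard = S.ncard := by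
        intro l p q hpq
        rw [← Set.ncard_inter_add_ncard_sdiff_eq_ncard S {x | l x = l p}]
        congr 2
        ext x
        simp only [Set.mem_inter_iff, Set.mem_ofPred_eq, Set.mem_sdiff]
        exact and_congr_right fun _ => ⟨fun h h' => hpq (h' ▸ h), fun h => hz2 hpq _ h⟩
      have hexp : (2 : ℕ) ^ (e + 1 - r) = 2 * 2 ^ (e - r) := by
        rw [show e + 1 - r = (e - r) + 1 by omega, pow_succ, mul_comm]
      set h := 2 ^ (e - r) with hh
      have hhpos : 0 < h := by positivity
      -- a section of size less than `3 * h / 2` is a flat of size `h`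
      have hflat : ∀ (l : V →ₗ[ZMod 2] ZMod 2) (p : V), l ≠ 0 → f p ≠ 0 →
          2 * (S ∩ {x | l x = l p}).ncard < 3 * h → ∃ (b : V) (U : Submodule (ZMod 2) V),
            U ≤ LinearMap.ker l ∧ Module.finrank (ZMod 2) U = e - r ∧ f b ≠ 0 ∧ l b = l p ∧
            (S ∩ {x | l x = l p}).ncard = h ∧
            ∀ x ∈ S ∩ {x | l x = l p}, x - b ∈ U := by
        intro l p hl hp hlt
        obtain ⟨b, U, hU, hb⟩ := ih (hker l hl) hre (hres r l p hf)
          (fun h => hp (by simpa using congrFun h 0))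
          (by rwa [ncard_support_restrict_hyperplane])
        refine ⟨p + b, U.map (LinearMap.ker l).subtype, ?_, ?_, ?_, by simp, ?_, ?_⟩
        · exact Submodule.map_subtype_le _ _
        · rw [LinearEquiv.finrank_eq (Submodule.equivSubtypeMap _ U).symm, hU]
        · exact (hb b).2 (by simp)
        · rw [← ncard_support_restrict_hyperplane]
          have : (support fun w : LinearMap.ker l => f (p + w)) =
              (fun w => w + b) '' (U : Set (LinearMap.ker l)) := by
            ext x
            simp only [mem_support, hb, Set.mem_image, SetLike.mem_coe]
            exact ⟨fun h => ⟨_, h, by simp⟩, by rintro ⟨w, hw, rfl⟩; simpa using hw⟩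
          rw [this, Set.ncard_image_of_injective _ (add_left_injective b),
            ← Nat.card_coe_set_eq]
          have := Module.natCard_eq_pow_finrank (K := ZMod 2) (V := U)
          rw [hU, Nat.card_zmod] at this
          exact this
        · rintro x ⟨hx, hlx⟩
          have hlx : l x = l p := hlx
          have := (hb ⟨x - p, by simp [hlx]⟩).1 (by simpa [hSdef] using hx)
          exact ⟨_, this, by simp [sub_sub]⟩
      -- one of the two complementary sections is that small, so every section by a hyperplane that
      -- meets the support has size `h` or `|S| - h`
      have htwo : ∀ (l : V →ₗ[ZMod 2] ZMod 2) (p : V), l ≠ 0 → f p ≠ 0 →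
          (S ∩ {x | l x = l p}).ncard = h ∨ (S ∩ {x | l x = l p}).ncard + h = S.ncard := by
        intro l p hl hp
        obtain ⟨q, hq, hfq⟩ := hvan l (l p + 1) hl
        have hpq : l p ≠ l q := by rw [hq]; simp
        have hs := hsplit l p q hpq
        by_cases hlt : 2 * (S ∩ {x | l x = l p}).ncard < 3 * h
        · obtain ⟨_, _, -, -, -, -, hc, -⟩ := hflat l p hl hp hlt
          exact Or.inl hc
        · obtain ⟨_, _, -, -, -, -, hc, -⟩ := hflat l q hl hfq (by omega)
          exact Or.inr (by omega)
      obtain ⟨l, hl⟩ : ∃ l : V →ₗ[ZMod 2] ZMod 2, l ≠ 0 := by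
        have : Nontrivial V := Module.nontrivial_of_finrank_pos (R := ZMod 2) (by omega)
        exact exists_ne 0
      obtain ⟨p, hp, hlt⟩ : ∃ p, f p ≠ 0 ∧ 2 * (S ∩ {x | l x = l p}).ncard < 3 * h := by
        obtain ⟨q, hq, hfq⟩ := hvan l (l a + 1) hl
        have hpq : l a ≠ l q := by rw [hq]; simp
        have hs := hsplit l a q hpq
        by_cases hlt : 2 * (S ∩ {x | l x = l a}).ncard < 3 * h
        · exact ⟨a, ha, hlt⟩
        · exact ⟨q, hfq, by omega⟩
      obtain ⟨b, U, hUl, hU, hfb, hlb, hA, hAU⟩ := hflat l p hl hp hlt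
      -- `U` has codimension `r + 1 ≥ 2`, so a functional `m ∉ {0, l}` vanishes on it; then `l`, `m`
      -- and `l + m` are all constant on the small half of the support
      obtain ⟨v, hvl, hvU⟩ := SetLike.exists_of_lt (lt_of_le_of_ne hUl fun h => by
        have := hker l hl
        rw [← h, hU] at this
        omega)
      obtain ⟨m, hmv, hUm⟩ := Submodule.exists_le_ker_of_notMem hvU
      have hm : m ≠ 0 := fun h => hmv (by simp [h])
      have hlm : l + m ≠ 0 := fun h => hmv (by
        have := LinearMap.congr_fun h v
        simpa [LinearMap.mem_ker.1 hvl] using this)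
      rw [← hlb] at hA hAU
      obtain ⟨q, hq, hfq⟩ := hvan l (l b + 1) hl
      have hbq : l b ≠ l q := by rw [hq]; simp
      have hBS : S \ {x | l x = l b} = S ∩ {x | l x = l q} := by
        ext x
        exact and_congr_right fun _ => ⟨fun h => hz2 hbq _ h, fun h h' => hbq (h'.symm.trans h)⟩
      have hS := Set.ncard_inter_add_ncard_sdiff_eq_ncard S {x | l x = l b}
      have hAm : ∀ x ∈ S, l x = l b → m x = m b := fun x hx hlx => by
        have := hUm (hAU x ⟨hx, hlx⟩)
        simpa [sub_eq_zero] using this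
      have hm1 := ncard_inter_of_subset (S := S) (P := {x | l x = l b}) (Q := {x | m x = m b}) hAm
      have hm2 := ncard_inter_of_subset (S := S) (P := {x | l x = l b})
        (Q := {x | (l + m) x = (l + m) b}) fun x hx hlx =>
          congrArg₂ (· + ·) hlx (hAm x hx hlx)
      have hm2' : (S \ {x | l x = l b}) ∩ {x | (l + m) x = (l + m) b} =
          (S \ {x | l x = l b}) \ {x | m x = m b} := by
        have key : ∀ a b c d : ZMod 2, a ≠ b → (a + c = b + d ↔ c ≠ d) := by decide
        ext x
        exact and_congr_right fun hx => key _ _ _ _ hx.2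
      rw [hm2'] at hm2
      have hBs := Set.ncard_inter_add_ncard_sdiff_eq_ncard (S \ {x | l x = l b}) {x | m x = m b}
      have hBge : h ≤ (S \ {x | l x = l b}).ncard := by
        rw [hBS]
        exact hf.two_pow_le_ncard_support_inter hV hre hl hfq
      -- The large half has size `|S| - h` and is split by `m` into two parts, each of size `0` or
      -- `|S| - 2 * h`. As `2 * h ≤ |S|`, this forces `|S| = 3 * h`, against the weight bound.
      rcases htwo m b hm hfb with h1 | h1 <;> rcases htwo (l + m) b hlm hfb with h2 | h2 <;> omega

section Codes

open MvPolynomial Matrix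

/-! ### Reed-Muller codes and their duality -/

theorem HasDegLE.mul_eval_monomial {n : ℕ} (d : Fin n →₀ ℕ) {s : ℕ} {g : Word n}
    (hg : HasDegLE s g) :
    HasDegLE (s + d.degree) fun x : Pt n => eval x (monomial d (1 : ZMod 2)) * g x := by
  induction d using Finsupp.induction_linear generalizing s g with
  | zero => simpa using hg
  | add d e hd he =>
    rw [map_add, add_comm d.degree, ← add_assoc]
    convert hd (he hg) using 2 with x
    rw [← mul_assoc, ← map_mul, monomial_mul, one_mul]
  | single i b =>
    rw [Finsupp.degree_single]
    induction b with
    | zero => simpa using hg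
    | succ b ih =>
      have h := ih.mul_hom (LinearMap.proj (R := ZMod 2) (φ := fun _ : Fin n => ZMod 2) i
        ).toAddMonoidHom
      refine (congrArg (HasDegLE _) (funext fun x => ?_)).mp h
      simp only [monomial_add_single, Finsupp.single_add, map_mul, eval_X, pow_one]
      exact (by intro a b c; ring : ∀ a b c : ZMod 2, a * (b * c) = b * a * c) _ _ _

theorem hasDegLE_of_mem_reedMuller {n r : ℕ} {c : Word n} (hc : c ∈ reedMuller r n) :
    HasDegLE r c := by
  obtain ⟨p, hp, hpc⟩ := mem_reedMuller.1 hc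
  have hsum : ∀ t ⊆ p.support, HasDegLE r fun x : Pt n =>
      ∑ d ∈ t, eval x (monomial d (p.coeff d)) := by
    intro t ht
    induction t using Finset.induction_on with
    | empty => simpa using HasDegLE.const r 0
    | insert d t hdt ih =>
      simp only [Finset.sum_insert hdt]
      refine HasDegLE.add ?_ (ih ((Finset.subset_insert d t).trans ht))
      have hd : d.degree ≤ r :=
        (le_totalDegree (ht (Finset.mem_insert_self d t))).trans hp
      have := (HasDegLE.const (V := Pt n) 0 (p.coeff d)).mul_eval_monomial d
      rw [zero_add] at this
      simpa [eval_monomial, mul_comm] using this.mono hd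
  convert hsum _ subset_rfl using 2 with x
  rw [← hpc, ← map_sum, ← as_sum]

theorem hammingNorm_eq_ncard_support {n : ℕ} (c : Word n) :
    hammingNorm c = (Function.support c).ncard := by
  rw [hammingNorm, ← Set.ncard_coe_finset]
  congr 1
  ext x
  simp

open Classical in
/-- The indicator of `{x | L x = y}` is a product of `r` affine forms. -/
theorem indicator_mem_reedMuller {n r : ℕ} (L : Pt n →ₗ[ZMod 2] (Fin r → ZMod 2))
    (y : Fin r → ZMod 2) : (fun x => if L x = y then 1 else 0) ∈ reedMuller r n := by
  refine mem_reedMuller.2 ⟨∏ i, (∑ j, C (L (Pi.single j 1) i) * X j + C (y i + 1)), ?_, ?_⟩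
  · refine (totalDegree_finsetProd _ _).trans ?_
    refine (Finset.sum_le_card_nsmul _ _ 1 fun i _ => ?_).trans (by simp)
    refine (totalDegree_add _ _).trans (max_le ?_ ?_)
    swap
    · rw [totalDegree_C]
      exact zero_le_one
    refine totalDegree_finsetSum_le fun j _ => ?_
    refine (totalDegree_mul _ _).trans ?_
    simp
  · intro x
    have hL : ∀ i, L x i = ∑ j, L (Pi.single j 1) i * x j := fun i => by
      have := congrFun (congrArg L (pi_eq_sum_univ' x)) i
      simpa [mul_comm, ← Pi.single_apply] using this
    simp only [map_prod, map_add, map_sum, map_mul, eval_C, eval_X, ← hL]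
    have key : ∀ a b : ZMod 2, a + (b + 1) = if a = b then 1 else 0 := by decide
    simp only [key]
    rw [Finset.prod_ite_zero]
    simp [_root_.funext_iff]

/-- One half of the duality of Reed-Muller codes: functions of degree less than `n` sum to zero. -/
theorem dotProduct_eq_zero_of_algDegree_lt {n r : ℕ} (hr : r ≤ n) {f c : Word n}
    (hf : algDegree f < n - r) (hc : c ∈ reedMuller r n) : f ⬝ᵥ c = 0 := by
  obtain ⟨p, hp, hpc⟩ := mem_reedMuller.1 hc
  have := sum_eval_eq_zero (anf f * p) (by
    refine (totalDegree_mul _ _).trans_lt ?_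
    rw [algDegree] at hf
    simp
    omega)
  simpa [dotProduct, (anf_spec f).2, hpc] using this

/-- A monomial function sums to zero over `F_2^n` unless every variable occurs in it. -/
theorem sum_prod_pow_zmod_two {n : ℕ} (e : Fin n → ℕ) :
    ∑ x : Pt n, ∏ i, x i ^ e i = if ∀ i, e i ≠ 0 then 1 else 0 := by
  have h : ∀ k : ℕ, ∑ a : ZMod 2, a ^ k = if k ≠ 0 then 1 else 0 := by
    intro k
    have : (Finset.univ : Finset (ZMod 2)) = {0, 1} := rfl
    rw [this, Finset.sum_pair zero_ne_one]
    rcases eq_or_ne k 0 with rfl | hk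
    · decide
    · simp [hk]
  rw [← Fintype.piFinset_univ,
    ← Finset.prod_univ_sum (fun _ => Finset.univ) fun i (a : ZMod 2) => a ^ e i]
  simp only [h, Finset.prod_ite_zero]
  simp

/-- The other half of the duality of Reed-Muller codes: a monomial of top degree in the algebraic
normal form of `f` is detected by pairing `f` with the product of the remaining variables. -/
theorem algDegree_lt_of_dotProduct_eq_zero {n r : ℕ} (hr : r < n) {f : Word n}
    (hf : ∀ c ∈ reedMuller r n, f ⬝ᵥ c = 0) : algDegree f < n - r := by
  by_contra! hdeg
  have h0 : (anf f) ≠ 0 := by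
    intro h
    simp [algDegree, h] at hdeg
    omega
  obtain ⟨d, hd, hdd⟩ := Finset.exists_mem_eq_sup _ (support_nonempty.2 h0)
    fun s : Fin n →₀ ℕ => s.sum fun _ e => e
  change algDegree f = d.degree at hdd
  have hle1 : ∀ d ∈ (anf f).support, ∀ i, d i ≤ 1 :=
    (mem_restrictDegree _ _ _).1 (anf_spec f).1
  have hc : (fun x : Pt n => ∏ i, x i ^ (1 - d i)) ∈ reedMuller r n := by
    refine mem_reedMuller.2 ⟨∏ i, X i ^ (1 - d i), ?_, fun x => by simp⟩
    refine (totalDegree_finsetProd _ _).trans ?_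
    simp only [totalDegree_X_pow]
    have : ∑ i, (1 - d i) + d.degree = n := by
      rw [Finsupp.degree_eq_sum, ← Finset.sum_add_distrib,
        Finset.sum_congr rfl fun i _ => Nat.sub_add_cancel (hle1 d hd i)]
      simp
    omega
  have h1 : ∑ x : Pt n, f x * ∏ i, x i ^ (1 - d i) = (anf f).coeff d := by
    have : ∀ x : Pt n, f x * ∏ i, x i ^ (1 - d i) =
        ∑ e ∈ (anf f).support, (anf f).coeff e * ∏ i, x i ^ (e i + (1 - d i)) := fun x => by
      rw [← (anf_spec f).2 x, eval_eq', Finset.sum_mul]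
      simp only [pow_add, Finset.prod_mul_distrib, mul_assoc]
    simp only [this]
    rw [Finset.sum_comm]
    simp only [← Finset.mul_sum, sum_prod_pow_zmod_two]
    rw [Finset.sum_eq_single_of_mem d hd]
    · have : ∀ i, d i + (1 - d i) ≠ 0 := fun i => by omega
      rw [if_pos this, mul_one]
    · -- a monomial `e ≠ d` covering all variables of `d` would have larger degree than `d`
      intro e he hed
      rw [if_neg, mul_zero]
      intro h
      have hde : d ≤ e := fun i => by
        have := h i
        have := hle1 d hd i
        omega
      have hee : e.degree ≤ d.degree := hdd ▸ le_totalDegree he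
      obtain ⟨k, rfl⟩ := exists_add_of_le hde
      rw [map_add] at hee
      have : k = 0 := (Finsupp.degree_eq_zero_iff k).1 (by omega)
      exact hed (by simp [this])
  exact mem_support_iff.1 hd (h1.symm.trans (hf _ hc))

/-! ### Parity-check matrices of subcodes -/

theorem exists_dotProduct_eq_zero_of_ne_top {ι : Type*} [Fintype ι]
    {S : Submodule (ZMod 2) (ι → ZMod 2)} (hS : S ≠ ⊤) :
    ∃ v : ι → ZMod 2, v ≠ 0 ∧ ∀ y ∈ S, v ⬝ᵥ y = 0 := by
  classical
  obtain ⟨φ, hφ, hker⟩ := S.exists_le_ker_of_lt_top (lt_top_iff_ne_top.2 hS)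
  refine ⟨(dotProductEquiv (ZMod 2) ι).symm φ, by simpa using hφ, fun y hy => ?_⟩
  have := congrArg (fun ψ => ψ y) ((dotProductEquiv (ZMod 2) ι).apply_symm_apply φ)
  exact this.trans (hker hy)

theorem component_dotProduct {n m : ℕ} (F : Pt n → Pt m) (v : Pt m) (c : Word n) :
    component F v ⬝ᵥ c = v ⬝ᵥ (valueMatrix F) *ᵥ c := by
  have : component F v = v ᵥ* valueMatrix F := rfl
  rw [this, dotProduct_mulVec]

/-- `F` is non-degenerate if and only if the syndrome map `c ↦ ∑ x, c x • F x` is onto already on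
`RM(r, n)`, because the dual of `RM(r, n)` is the space of functions of degree less than `n - r`. -/
theorem not_isDegenerate_iff {n m r : ℕ} (hr : r < n) (F : Pt n → Pt m) :
    ¬ IsDegenerate (n - r) F ↔ ∀ y, ∃ c ∈ reedMuller r n, valueMatrix F *ᵥ c = y := by
  constructor
  · intro h
    by_contra hns
    have hne : (reedMuller r n).map (valueMatrix F).mulVecLin ≠ ⊤ := fun htop =>
      hns fun y => Submodule.mem_map.1 (htop ▸ Submodule.mem_top : y ∈ _)
    obtain ⟨v, hv, hvS⟩ := exists_dotProduct_eq_zero_of_ne_top hne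
    refine h ⟨v, hv, algDegree_lt_of_dotProduct_eq_zero hr fun c hc => ?_⟩
    rw [component_dotProduct]
    exact hvS _ (Submodule.mem_map_of_mem hc)
  · rintro h ⟨v, hv, hdeg⟩
    refine hv (dotProduct_eq_zero _ fun y => ?_)
    obtain ⟨c, hc, rfl⟩ := h y
    rw [← component_dotProduct]
    exact dotProduct_eq_zero_of_algDegree_lt hr.le hdeg hc

theorem isParityCheckMatrix_fromRows {n m r s : ℕ} {C : Submodule (ZMod 2) (Word n)}
    {F : Pt n → Pt m} (hC : ∀ c, c ∈ C ↔ c ∈ reedMuller r n ∧ valueMatrix F *ᵥ c = 0)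
    (hF : ∀ y, ∃ c ∈ reedMuller r n, valueMatrix F *ᵥ c = y)
    {H : Matrix (Fin s) (Pt n) (ZMod 2)} (hH : IsParityCheckMatrix H (reedMuller r n)) :
    IsParityCheckMatrix (fromRows H (valueMatrix F)) C := by
  refine ⟨?_, fun c => ?_⟩
  · rw [← vecMul_injective_iff]
    refine (injective_iff_map_eq_zero (fromRows H (valueMatrix F)).vecMulLinear).2 fun w hw => ?_
    rw [vecMulLinear_apply, vecMul_fromRows] at hw
    have hr : w ∘ Sum.inr = 0 := by
      refine dotProduct_eq_zero _ fun y => ?_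
      obtain ⟨c, hc, rfl⟩ := hF y
      have := congrArg (· ⬝ᵥ c) hw
      simpa [add_dotProduct, ← dotProduct_mulVec, (hH.2 c).1 hc] using this
    have hl : w ∘ Sum.inl = 0 := by
      rw [hr, zero_vecMul, add_zero] at hw
      exact vecMul_injective_iff.2 hH.1 (by simpa using hw)
    ext (i | i)
    exacts [congrFun hl i, congrFun hr i]
  · rw [hC, hH.2, fromRows_mulVec, ← Sum.elim_zero_zero]
    exact ⟨fun h => by rw [h.1, h.2], fun h => Sum.elim_eq_iff.1 h⟩

theorem mulVec_surjective_of_linearIndependent_row {ι κ : Type*} [Fintype ι] [Fintype κ]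
    {M : Matrix ι κ (ZMod 2)} (hM : LinearIndependent (ZMod 2) M.row) (y : ι → ZMod 2) :
    ∃ c, M *ᵥ c = y := by
  by_contra hns
  have hne : LinearMap.range M.mulVecLin ≠ ⊤ := fun htop =>
    hns (LinearMap.mem_range.1 (htop ▸ Submodule.mem_top : y ∈ _))
  obtain ⟨v, hv, hvS⟩ := exists_dotProduct_eq_zero_of_ne_top hne
  refine hv (vecMul_injective_iff.2 hM ?_)
  dsimp only
  rw [zero_vecMul]
  refine dotProduct_eq_zero _ fun c => ?_
  rw [← dotProduct_mulVec]
  exact hvS _ ⟨c, rfl⟩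

theorem mem_and_surjective_of_isParityCheckMatrix_fromRows {n m r s : ℕ}
    {C : Submodule (ZMod 2) (Word n)} {F : Pt n → Pt m}
    {H : Matrix (Fin s) (Pt n) (ZMod 2)} (hH : IsParityCheckMatrix H (reedMuller r n))
    (hHF : IsParityCheckMatrix (fromRows H (valueMatrix F)) C) :
    (∀ c, c ∈ C ↔ c ∈ reedMuller r n ∧ valueMatrix F *ᵥ c = 0) ∧
      ∀ y, ∃ c ∈ reedMuller r n, valueMatrix F *ᵥ c = y := by
  refine ⟨fun c => ?_, fun y => ?_⟩
  · rw [hHF.2, fromRows_mulVec, hH.2, ← Sum.elim_zero_zero]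
    exact Sum.elim_eq_iff
  · obtain ⟨c, hc⟩ := mulVec_surjective_of_linearIndependent_row hHF.1 (Sum.elim 0 y)
    rw [fromRows_mulVec, Sum.elim_eq_iff] at hc
    exact ⟨c, (hH.2 c).2 hc.1, hc.2⟩

/-- A subcode of codimension `m` is cut out by `m` linear functionals on `R`; extended to all words
and evaluated at the unit words, these are the coordinate functions of `F`. -/
theorem exists_valueMatrix_of_finrank_add {n m : ℕ} {C R : Submodule (ZMod 2) (Word n)}
    (hCR : C ≤ R) (hfin : Module.finrank (ZMod 2) C + m = Module.finrank (ZMod 2) R) :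
    ∃ F : Pt n → Pt m, (∀ c, c ∈ C ↔ c ∈ R ∧ valueMatrix F *ᵥ c = 0) ∧
      ∀ y, ∃ c ∈ R, valueMatrix F *ᵥ c = y := by
  have hq : Module.finrank (ZMod 2) (R ⧸ C.submoduleOf R) = Module.finrank (ZMod 2) (Pt m) := by
    have h1 := (C.submoduleOf R).finrank_quotient_add_finrank
    rw [(Submodule.submoduleOfEquivOfLe hCR).finrank_eq] at h1
    rw [Module.finrank_fin_fun]
    omega
  let e := LinearEquiv.ofFinrankEq _ _ hq
  obtain ⟨g, hg⟩ := LinearMap.exists_extend (e.toLinearMap ∘ₗ (C.submoduleOf R).mkQ)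
  have hg' : ∀ c : R, g c = e ((C.submoduleOf R).mkQ c) := fun c => LinearMap.congr_fun hg c
  have hF : ∀ c, valueMatrix (fun x i => LinearMap.toMatrix' g i x) *ᵥ c = g c :=
    fun c => LinearMap.toMatrix'_mulVec g c
  refine ⟨fun x i => LinearMap.toMatrix' g i x, fun c => ?_, fun y => ?_⟩
  · rw [hF]
    constructor
    · intro hc
      refine ⟨hCR hc, ?_⟩
      rw [hg' ⟨c, hCR hc⟩, e.map_eq_zero_iff, Submodule.mkQ_apply, Submodule.Quotient.mk_eq_zero]
      exact hc
    · rintro ⟨hc, h0⟩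
      rw [hg' ⟨c, hc⟩, e.map_eq_zero_iff, Submodule.mkQ_apply, Submodule.Quotient.mk_eq_zero] at h0
      exact h0
  · obtain ⟨q, rfl⟩ := e.surjective y
    obtain ⟨c, rfl⟩ := Submodule.mkQ_surjective _ q
    exact ⟨c, c.2, by rw [hF, hg' c]⟩

theorem finrank_inf_ker_valueMatrix {n m : ℕ} {R : Submodule (ZMod 2) (Word n)} {F : Pt n → Pt m}
    (hF : ∀ y, ∃ c ∈ R, valueMatrix F *ᵥ c = y) :
    Module.finrank (ZMod 2) (R ⊓ LinearMap.ker (valueMatrix F).mulVecLin : Submodule _ _) + m =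
      Module.finrank (ZMod 2) R := by
  have h := ((valueMatrix F).mulVecLin.domRestrict R).finrank_range_add_finrank_ker
  have hr : LinearMap.range ((valueMatrix F).mulVecLin.domRestrict R) = ⊤ :=
    LinearMap.range_eq_top.2 fun y => by
      obtain ⟨c, hc, hy⟩ := hF y
      exact ⟨⟨c, hc⟩, hy⟩
  have hk : LinearMap.ker ((valueMatrix F).mulVecLin.domRestrict R) =
      (R ⊓ LinearMap.ker (valueMatrix F).mulVecLin).submoduleOf R := by
    ext c
    simp [Submodule.submoduleOf]
  rw [hr, finrank_top, Module.finrank_fin_fun, hk,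
    (Submodule.submoduleOfEquivOfLe inf_le_left).finrank_eq] at h
  exact (add_comm _ _).trans h

/-! ### Sum-freeness and minimum distance -/

theorem valueMatrix_mulVec {n m : ℕ} (F : Pt n → Pt m) (c : Word n) :
    valueMatrix F *ᵥ c = ∑ x, c x • F x := by
  ext i
  simp [valueMatrix, mulVec, dotProduct, mul_comm]

theorem ncard_flat {n k : ℕ} {A : AffineSubspace (ZMod 2) (Pt n)} (hA : IsFlat k A) :
    (A : Set (Pt n)).ncard = 2 ^ k := by
  obtain ⟨⟨b, hb⟩, hk⟩ := hA
  have : (A : Set (Pt n)) = (fun w => w + b) '' (A.direction : Set (Pt n)) := by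
    ext x
    constructor
    · intro hx
      exact ⟨x - b, A.vsub_mem_direction hx hb, by simp⟩
    · rintro ⟨w, hw, rfl⟩
      exact AffineSubspace.vadd_mem_of_mem_direction hw hb
  rw [this, Set.ncard_image_of_injective _ (add_left_injective b), ← Nat.card_coe_set_eq]
  have := Module.natCard_eq_pow_finrank (K := ZMod 2) (V := A.direction)
  rw [hk, Nat.card_zmod] at this
  exact this

open Classical in
theorem indicator_flat_mem_reedMuller {n r : ℕ} (hr : r ≤ n)
    {A : AffineSubspace (ZMod 2) (Pt n)} (hA : IsFlat (n - r) A) :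
    (fun x => if x ∈ A then 1 else 0) ∈ reedMuller r n := by
  obtain ⟨⟨b, hb⟩, hk⟩ := hA
  have hq : Module.finrank (ZMod 2) (Pt n ⧸ A.direction) =
      Module.finrank (ZMod 2) (Fin r → ZMod 2) := by
    have h1 : Module.finrank (ZMod 2) (Pt n ⧸ A.direction) + _ = Module.finrank (ZMod 2) (Pt n) :=
      A.direction.finrank_quotient_add_finrank
    have h2 : Module.finrank (ZMod 2) (Pt n) = n := Module.finrank_fin_fun _
    rw [Module.finrank_fin_fun]
    omega
  let e := LinearEquiv.ofFinrankEq _ _ hq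
  let L := e.toLinearMap ∘ₗ A.direction.mkQ
  have h : ∀ x, x ∈ A ↔ L x = L b := fun x => by
    rw [← sub_eq_zero, ← map_sub]
    simp only [L, LinearMap.comp_apply, LinearEquiv.coe_coe, e.map_eq_zero_iff,
      Submodule.mkQ_apply, Submodule.Quotient.mk_eq_zero]
    exact (A.vsub_right_mem_direction_iff_mem hb x).symm
  simpa only [h] using indicator_mem_reedMuller L (L b)

theorem isSumFree_of_hasMinDist {n m r : ℕ} (hr : r < n) {C : Submodule (ZMod 2) (Word n)}
    {F : Pt n → Pt m} (hC : ∀ c, c ∈ C ↔ c ∈ reedMuller r n ∧ valueMatrix F *ᵥ c = 0)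
    (hd : HasMinDist C (3 * 2 ^ (n - r - 1))) : IsSumFree (n - r) F := by
  classical
  intro A hA hsum
  set c : Word n := fun x => if x ∈ A then 1 else 0 with hc
  have hcC : c ∈ C := by
    refine (hC c).2 ⟨indicator_flat_mem_reedMuller hr.le hA, ?_⟩
    rw [valueMatrix_mulVec, ← hsum, Finset.sum_filter]
    refine Finset.sum_congr rfl fun x _ => ?_
    simp only [hc, ite_smul, one_smul, zero_smul]
  have hsupp : Function.support c = (A : Set (Pt n)) := by
    ext x
    simp [hc]
  have hwt : hammingNorm c = 2 ^ (n - r) := by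
    rw [hammingNorm_eq_ncard_support, hsupp, ncard_flat hA]
  have hc0 : c ≠ 0 := fun h => by
    rw [h, hammingNorm_zero] at hwt
    exact (pow_ne_zero _ two_ne_zero) hwt.symm
  have := hd.2 ⟨c, hcC, 0, C.zero_mem, hc0, hammingDist_zero_right c⟩
  rw [hwt, show n - r = (n - r - 1) + 1 by omega, pow_succ] at this
  have : 0 < 2 ^ (n - r - 1) := by positivity
  simp only [Nat.add_sub_cancel] at *
  omega

theorem le_hammingNorm_of_isSumFree {n m r : ℕ} (hr : r < n) {F : Pt n → Pt m}
    (hF : IsSumFree (n - r) F) {c : Word n} (hc : c ∈ reedMuller r n) (hc0 : c ≠ 0)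
    (hFc : valueMatrix F *ᵥ c = 0) : 3 * 2 ^ (n - r - 1) ≤ hammingNorm c := by
  classical
  by_contra! hlt
  rw [hammingNorm_eq_ncard_support] at hlt
  have hpow : 2 ^ (n - r) = 2 * 2 ^ (n - r - 1) := by
    rw [← pow_succ', show n - r - 1 + 1 = n - r by omega]
  obtain ⟨b, U, hU, hb⟩ := (hasDegLE_of_mem_reedMuller hc).support_eq_flat
    (Module.finrank_fin_fun (ZMod 2)) hr.le hc0 (by omega)
  refine hF (AffineSubspace.mk' b U) ⟨⟨b, AffineSubspace.self_mem_mk' b U⟩,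
    by rwa [AffineSubspace.direction_mk']⟩ ?_
  rw [← hFc, valueMatrix_mulVec, Finset.sum_filter]
  refine Finset.sum_congr rfl fun x _ => ?_
  rw [AffineSubspace.mem_mk', vsub_eq_sub]
  split_ifs with hx
  · rw [(by decide : ∀ a : ZMod 2, a ≠ 0 → a = 1) _ ((hb x).2 hx), one_smul]
  · rw [not_not.1 (mt (hb x).1 hx), zero_smul]

/-! ### Attaining the minimum distance -/

theorem card_le_card_ker_mul_four {X Y : Type*} [AddCommGroup X] [Module (ZMod 2) X] [Finite X]
    [AddCommGroup Y] [Module (ZMod 2) Y] {φ : X →ₗ[ZMod 2] Y}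
    (h : Module.finrank (ZMod 2) (LinearMap.range φ) ≤ 2) :
    Nat.card X ≤ 4 * (LinearMap.ker φ : Set X).ncard := by
  have h1 := φ.finrank_range_add_finrank_ker
  have h2 := Module.natCard_eq_pow_finrank (K := ZMod 2) (V := LinearMap.ker φ)
  rw [Nat.card_zmod] at h2
  rw [← Nat.card_coe_set_eq, Module.natCard_eq_pow_finrank (K := ZMod 2) (V := X), Nat.card_zmod]
  refine le_of_le_of_eq ?_ (congrArg (4 * ·) h2.symm)
  calc 2 ^ Module.finrank (ZMod 2) X ≤ 2 ^ (2 + Module.finrank (ZMod 2) (LinearMap.ker φ)) :=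
        Nat.pow_le_pow_right two_pos (by omega)
    _ = _ := by rw [pow_add]; norm_num

theorem card_linearMap_zmod_two (a b : ℕ) :
    Nat.card ((Fin a → ZMod 2) →ₗ[ZMod 2] (Fin b → ZMod 2)) = 2 ^ (a * b) := by
  rw [Module.natCard_eq_pow_finrank (K := ZMod 2), Nat.card_zmod, Module.finrank_linearMap]
  simp

/-- A family of `2 ^ (k + r)` linear maps whose pairwise differences have rank at most `2`: the maps
`F_2^k → F_2^r` factoring through a fixed surjection onto `F_2^2` (if `k ≤ r`) or through a fixed
injection of `F_2^2` (if `r ≤ k`). -/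
theorem exists_linearMap_family {k r : ℕ} (hk : 2 ≤ k) (hr : 2 ≤ r) :
    ∃ D : Finset ((Fin k → ZMod 2) →ₗ[ZMod 2] (Fin r → ZMod 2)),
      2 ^ (k + r) ≤ D.card ∧ ∀ φ ∈ D, ∀ ψ ∈ D,
        Module.finrank (ZMod 2) (LinearMap.range (φ - ψ)) ≤ 2 := by
  classical
  have hproj : ∀ {a : ℕ}, 2 ≤ a →
      ∃ p : (Fin a → ZMod 2) →ₗ[ZMod 2] (Fin 2 → ZMod 2), Function.Surjective p := fun ha =>
    ⟨LinearMap.funLeft (ZMod 2) (ZMod 2) (Fin.castLE ha),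
      LinearMap.funLeft_surjective_of_injective _ _ _ (Fin.castLE_injective ha)⟩
  have hfin : ∀ a b, Finite ((Fin a → ZMod 2) →ₗ[ZMod 2] (Fin b → ZMod 2)) := fun a b =>
    Module.finite_of_finite (ZMod 2)
  rcases le_total k r with hkr | hkr
  · obtain ⟨p, hp⟩ := hproj hk
    have := Fintype.ofFinite ((Fin 2 → ZMod 2) →ₗ[ZMod 2] (Fin r → ZMod 2))
    refine ⟨Finset.univ.image fun φ => φ ∘ₗ p, ?_, ?_⟩
    · rw [Finset.card_image_of_injective _ fun φ ψ h => LinearMap.cancel_right hp |>.1 h,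
        Finset.card_univ, ← Nat.card_eq_fintype_card, card_linearMap_zmod_two]
      exact Nat.pow_le_pow_right two_pos (by omega)
    · simp only [Finset.mem_image, Finset.mem_univ, true_and]
      rintro _ ⟨φ, rfl⟩ _ ⟨ψ, rfl⟩
      rw [← LinearMap.sub_comp]
      refine (Submodule.finrank_mono (LinearMap.range_comp_le_range _ _)).trans ?_
      exact (LinearMap.finrank_range_le _).trans (by simp)
  · obtain ⟨p, hp⟩ := hproj hr
    obtain ⟨ι, hι⟩ := p.exists_rightInverse_of_surjective (LinearMap.range_eq_top.2 hp)
    have hinj : Function.Injective ι := fun x y h => by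
      have := congrArg p h
      rwa [← LinearMap.comp_apply, ← LinearMap.comp_apply, hι] at this
    have := Fintype.ofFinite ((Fin k → ZMod 2) →ₗ[ZMod 2] (Fin 2 → ZMod 2))
    refine ⟨Finset.univ.image fun φ => ι ∘ₗ φ, ?_, ?_⟩
    · rw [Finset.card_image_of_injective _ fun φ ψ h => LinearMap.cancel_left hinj |>.1 h,
        Finset.card_univ, ← Nat.card_eq_fintype_card, card_linearMap_zmod_two]
      exact Nat.pow_le_pow_right two_pos (by omega)
    · simp only [Finset.mem_image, Finset.mem_univ, true_and]
      rintro _ ⟨φ, rfl⟩ _ ⟨ψ, rfl⟩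
      rw [← LinearMap.comp_sub, LinearMap.range_comp]
      refine (Submodule.finrank_map_le _ _).trans ?_
      exact (Submodule.finrank_le _).trans (by simp)

open Classical in
/-- The indicator of the graph of `φ : F_2^k → F_2^r`, a `k`-flat of `F_2^n`, transported along an
identification `e` of `F_2^n` with `F_2^k × F_2^r`. -/
noncomputable def graphWord {n k r : ℕ}
    (e : Pt n ≃ₗ[ZMod 2] (Fin k → ZMod 2) × (Fin r → ZMod 2))
    (φ : (Fin k → ZMod 2) →ₗ[ZMod 2] (Fin r → ZMod 2)) : Word n :=
  fun x => if (e x).2 = φ (e x).1 then 1 else 0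

section GraphWord

variable {n k r : ℕ} (e : Pt n ≃ₗ[ZMod 2] (Fin k → ZMod 2) × (Fin r → ZMod 2))
  (φ ψ : (Fin k → ZMod 2) →ₗ[ZMod 2] (Fin r → ZMod 2))

theorem graphWord_mem_reedMuller : graphWord e φ ∈ reedMuller r n := by
  have := indicator_mem_reedMuller
    ((LinearMap.snd _ _ _ - φ ∘ₗ LinearMap.fst _ _ _) ∘ₗ e.toLinearMap) 0
  simp only [LinearMap.comp_apply, LinearMap.sub_apply, sub_eq_zero] at this
  exact this

theorem graphWord_ne_zero : graphWord e φ ≠ 0 := fun h => by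
  simpa [graphWord] using congrFun h 0

theorem graphWord_injective : Function.Injective (graphWord e) := fun φ ψ h => by
  refine LinearMap.ext fun x => ?_
  by_contra hx
  have := congrFun h (e.symm (x, φ x))
  simp [graphWord, hx] at this

theorem hammingNorm_graphWord_le : hammingNorm (graphWord e φ) ≤ 2 ^ k := by
  rw [hammingNorm_eq_ncard_support]
  have hsub : Function.support (graphWord e φ) ⊆
      (fun x => e.symm (x, φ x)) '' (Set.univ : Set (Fin k → ZMod 2)) := by
    intro x hx
    have h : (e x).2 = φ (e x).1 := by simpa [graphWord] using hx
    exact ⟨(e x).1, trivial, by simp [← h]⟩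
  refine (Set.ncard_le_ncard hsub).trans ((Set.ncard_image_le (Set.toFinite _)).trans ?_)
  simp [Set.ncard_univ]

/-- The two graphs agree over the kernel of `φ - ψ`, which has codimension at most `2`, so their
symmetric difference has at most `2 * (2 ^ k - 2 ^ (k - 2))` points. -/
theorem hammingNorm_graphWord_sub_le (hk : 2 ≤ k)
    (h : Module.finrank (ZMod 2) (LinearMap.range (φ - ψ)) ≤ 2) :
    hammingNorm (graphWord e φ - graphWord e ψ) ≤ 3 * 2 ^ (k - 1) := by
  rw [hammingNorm_eq_ncard_support]
  set K : Set (Fin k → ZMod 2) := (LinearMap.ker (φ - ψ) : Set (Fin k → ZMod 2))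
  have hsub : Function.support (graphWord e φ - graphWord e ψ) ⊆
      (fun x => e.symm (x, φ x)) '' Kᶜ ∪ (fun x => e.symm (x, ψ x)) '' Kᶜ := by
    intro x hx
    have hx : graphWord e φ x - graphWord e ψ x ≠ 0 := hx
    by_cases h1 : (e x).2 = φ (e x).1 <;> by_cases h2 : (e x).2 = ψ (e x).1
    · simp [graphWord, ← h1, ← h2] at hx
    · refine Or.inl ⟨(e x).1, fun hK => h2 ?_, by simp [← h1]⟩
      rw [h1]
      exact sub_eq_zero.1 (LinearMap.mem_ker.1 hK)
    · refine Or.inr ⟨(e x).1, fun hK => h1 ?_, by simp [← h2]⟩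
      rw [h2]
      exact (sub_eq_zero.1 (LinearMap.mem_ker.1 hK)).symm
    · simp [graphWord, h1, h2] at hx
  have h1 := (Set.ncard_le_ncard hsub).trans (Set.ncard_union_le _ _)
  have h2 := Set.ncard_image_le (f := fun x => e.symm (x, φ x)) (s := Kᶜ)
  have h3 := Set.ncard_image_le (f := fun x => e.symm (x, ψ x)) (s := Kᶜ)
  have h4 := card_le_card_ker_mul_four h
  have h5 := Set.ncard_add_ncard_compl K
  have h6 : Nat.card (Fin k → ZMod 2) = 2 * 2 ^ (k - 1) := by
    rw [← pow_succ', show k - 1 + 1 = k by omega]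
    simp
  change Nat.card (Fin k → ZMod 2) ≤ 4 * K.ncard at h4
  omega

end GraphWord

theorem hasMinDist_of_isSumFree {n m r : ℕ} (hr : 2 ≤ r) (hrn : r + 2 ≤ n) (hmn : m ≤ n)
    {F : Pt n → Pt m} (hF : IsSumFree (n - r) F) {C : Submodule (ZMod 2) (Word n)}
    (hC : ∀ c, c ∈ C ↔ c ∈ reedMuller r n ∧ valueMatrix F *ᵥ c = 0) :
    HasMinDist C (3 * 2 ^ (n - r - 1)) := by
  have hlb : ∀ c ∈ reedMuller r n, c ≠ 0 → valueMatrix F *ᵥ c = 0 →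
      3 * 2 ^ (n - r - 1) ≤ hammingNorm c := fun c hc hc0 h =>
    le_hammingNorm_of_isSumFree (by omega) hF hc hc0 h
  refine ⟨?_, ?_⟩
  · obtain ⟨D, hD, hrank⟩ := exists_linearMap_family (k := n - r) (by omega) hr
    let e : Pt n ≃ₗ[ZMod 2] (Fin (n - r) → ZMod 2) × (Fin r → ZMod 2) :=
      LinearEquiv.ofFinrankEq _ _ (by
        rw [Module.finrank_prod, Module.finrank_fin_fun, Module.finrank_fin_fun,
          Module.finrank_fin_fun]
        omega)
    have hpow : 2 ^ (n - r) = 2 * 2 ^ (n - r - 1) := by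
      rw [← pow_succ', show n - r - 1 + 1 = n - r by omega]
    have hpos : 0 < 2 ^ (n - r - 1) := by positivity
    -- by the lower bound, a word of weight `2 ^ (n - r)` is not in `C`, so its syndrome is nonzero;
    -- this leaves `2 ^ m - 1 < 2 ^ n` syndromes
    have hmaps : ∀ φ ∈ D, valueMatrix F *ᵥ graphWord e φ ∈ Finset.univ.erase (0 : Pt m) := by
      intro φ _
      refine Finset.mem_erase.2 ⟨fun h => ?_, Finset.mem_univ _⟩
      have h1 := hlb _ (graphWord_mem_reedMuller e φ) (graphWord_ne_zero e φ) h
      have h2 := hammingNorm_graphWord_le e φ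
      omega
    have hcard : (Finset.univ.erase (0 : Pt m)).card < D.card := by
      rw [Finset.card_erase_of_mem (Finset.mem_univ _), Finset.card_univ]
      have h1 : Fintype.card (Pt m) = 2 ^ m := by simp
      have h2 : 2 ^ m ≤ 2 ^ (n - r + r) := Nat.pow_le_pow_right two_pos (by omega)
      have h3 : 0 < 2 ^ m := by positivity
      omega
    obtain ⟨φ, hφ, ψ, hψ, hne, heq⟩ := Finset.exists_ne_map_eq_of_card_lt_of_maps_to hcard hmaps
    have hmem : ∀ φ, graphWord e φ ∈ reedMuller r n := graphWord_mem_reedMuller e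
    have hsub : graphWord e φ - graphWord e ψ ∈ C :=
      (hC _).2 ⟨Submodule.sub_mem _ (hmem φ) (hmem ψ), by rw [mulVec_sub, heq, sub_self]⟩
    have hne' : graphWord e φ - graphWord e ψ ≠ 0 :=
      sub_ne_zero.2 ((graphWord_injective e).ne hne)
    refine ⟨_, hsub, 0, C.zero_mem, hne', ?_⟩
    rw [hammingDist_zero_right]
    have h := (hC _).1 hsub
    exact le_antisymm (hammingNorm_graphWord_sub_le e φ ψ (by omega) (hrank φ hφ ψ hψ))
      (hlb _ h.1 hne' h.2)
  · rintro _ ⟨x, hx, y, hy, hxy, rfl⟩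
    have h := (hC _).1 (C.sub_mem hy hx)
    rw [hammingDist_eq_hammingNorm, neg_add_eq_sub]
    exact hlb _ h.1 (sub_ne_zero.2 hxy.symm) h.2

end Codes

theorem theorem1p1 (r m n : ℕ) (hr : 2 ≤ r) (hrn : r + 2 ≤ n) (hm : 1 ≤ m) (hmn : m ≤ n) :
    (∀ C : Submodule (ZMod 2) (Word n),
      C ≤ reedMuller r n →
      Module.finrank (ZMod 2) C + m = Module.finrank (ZMod 2) (reedMuller r n) →
      HasMinDist C (3 * 2 ^ (n - r - 1)) →
      (∃ F : Pt n → Pt m, IsSumFree (n - r) F ∧ ¬ IsDegenerate (n - r) F ∧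
        ∀ (s : ℕ) (H : Matrix (Fin s) (Pt n) (ZMod 2)),
          IsParityCheckMatrix H (reedMuller r n) →
          IsParityCheckMatrix (Matrix.fromRows H (valueMatrix F)) C) ∧
      (∀ (s : ℕ) (H : Matrix (Fin s) (Pt n) (ZMod 2)) (F : Pt n → Pt m),
        IsParityCheckMatrix H (reedMuller r n) →
        IsParityCheckMatrix (Matrix.fromRows H (valueMatrix F)) C →
        IsSumFree (n - r) F ∧ ¬ IsDegenerate (n - r) F)) ∧
    (∀ F : Pt n → Pt m, IsSumFree (n - r) F → ¬ IsDegenerate (n - r) F →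
      ∃ C : Submodule (ZMod 2) (Word n),
        C ≤ reedMuller r n ∧
        Module.finrank (ZMod 2) C + m = Module.finrank (ZMod 2) (reedMuller r n) ∧
        HasMinDist C (3 * 2 ^ (n - r - 1)) ∧
        ∀ (s : ℕ) (H : Matrix (Fin s) (Pt n) (ZMod 2)),
          IsParityCheckMatrix H (reedMuller r n) →
          IsParityCheckMatrix (Matrix.fromRows H (valueMatrix F)) C) := by

  refine ⟨fun C hCR hfin hd => ⟨?_, fun s H F hH hHF => ?_⟩, fun F hF hdeg => ?_⟩
  · obtain ⟨F, hC, hF⟩ := exists_valueMatrix_of_finrank_add hCR hfin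
    exact ⟨F, isSumFree_of_hasMinDist (by omega) hC hd, (not_isDegenerate_iff (by omega) F).2 hF,
      fun s H hH => isParityCheckMatrix_fromRows hC hF hH⟩
  · obtain ⟨hC, hF⟩ := mem_and_surjective_of_isParityCheckMatrix_fromRows hH hHF
    exact ⟨isSumFree_of_hasMinDist (by omega) hC hd, (not_isDegenerate_iff (by omega) F).2 hF⟩
  · have hsurj := (not_isDegenerate_iff (by omega) F).1 hdeg
    have hC : ∀ c, c ∈ reedMuller r n ⊓ LinearMap.ker (valueMatrix F).mulVecLin ↔
        c ∈ reedMuller r n ∧ (valueMatrix F).mulVec c = 0 := fun c => Iff.rfl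
    exact ⟨_, inf_le_left, finrank_inf_ker_valueMatrix hsurj,
      hasMinDist_of_isSumFree hr hrn hmn hF hC,
      fun s H hH => isParityCheckMatrix_fromRows hC hsurj hH⟩
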